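/- Let $\mathbb U=\{z\in\mathbb C:|z|<1\}$. For $g,h$ holomorphic in $\mathbb U$ write $g\prec h$ ($g$ is subordinate to $h$) if $g=h\circ\omega$ on $\mathbb U$ for some holomorphic $\omega:\mathbb U\to\mathbb U$ with $\omega(0)=0$. *Univalent* means holomorphic and injective in $\mathbb U$; a *convex* function is a univalent function whose image $q(\mathbb U)$ is convex. Let $\mathcal H[1,1]$ be the set of holomorphic functions $1+a_1z+a_2z^2+\cdots$ in $\mathbb U$, and let $\mathcal Q$ be the set of functions $g$ that are analytic and injective on $\overline{\mathbb U}\setminus E(g)$, where $E(g)=\{\zeta\in\partial\mathbb U:\lim_{z\to\zeta,\,z\in\mathbb U}g(z)=\infty\}$, and satisfy $|g'(\zeta)|\ge\rho$ for some $\rho>0$ and all $\zeta\in\partial\mathbb U\setminus E(g)$. Let $p\ge 1$ be an integer, let $\eta,\mu\in\mathbb C$ be not both zero, let $\sigma\in\mathbb C$ and $\gamma\in\mathbb C\setminus\{0\}$ satisfy $\operatorname{Re}(\sigma/\gamma)>0$, and let $f(z)=z^p+\sum_{k\ge p+1}a_kz^k$ be holomorphic in $\mathbb U$. Put $$F(z)=F_p^{\eta,\mu}[f](z)=\Big[\frac{f'(z)}{pz^{p-1}}\Big]^{\eta}\Big[\frac{z^p}{f(z)}\Big]^{\mu},$$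 $$\Psi(z)=\Big[\frac{f'(z)}{pz^{p-1}}\Big]^{\eta}\Big[\frac{z^p}{f(z)}\Big]^{\mu}\Big\{\sigma+\gamma\Big[\eta\Big(1-p+\frac{zf''(z)}{f'(z)}\Big)+\mu\Big(p-\frac{zf'(z)}{f(z)}\Big)\Big]\Big\}.$$ The powers are principal near $z=0$, where both bases tend to $1$ (so $F(0)=1$), and $F$ and $\Psi$ denote the holomorphic functions in $\mathbb U$ that are given by these formulas for small $z\ne0$, whenever such functions exist. Let $q_1$ and $q_2$ be convex functions in $\mathbb U$ with $q_1(0)=q_2(0)=1$, and put $h_i(z)=\sigma q_i(z)+\gamma zq_i'(z)$. Suppose that $F\in\mathcal H[1,1]\cap\mathcal Q$, that $\Psi$ is univalent in $\mathbb U$, and that $$h_1\prec\Psi\prec h_2 .$$ Then $$q_1\prec F\prec q_2 .$$ Moreover, $h_1,h_2$ are univalent, and $q_1$ and $q_2$ are respectively the best subordinant and the best dominant, in the following sense. Let $\mathcal S_1$ be the set of univalent $u$ for which $\sigma u+\gamma zu'$ is univalent and $h_1\prec\sigma u+\gamma zu'$. Let $\mathcal S_2$ be the set of holomorphic $u$ in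 $\mathbb U$ for which $\sigma u+\gamma zu'\prec h_2$. 1. For $\mathcal S=\mathcal S_1$, and also for $\mathcal S=\mathcal S_1\cap\mathcal S_2$: $q_1\prec u$ for all $u\in\mathcal S$, and $r\prec q_1$ for every holomorphic $r$ in $\mathbb U$ such that $r\prec u$ for all $u\in\mathcal S$. 2. For $\mathcal S=\mathcal S_2$, and also for $\mathcal S=\mathcal S_1\cap\mathcal S_2$: $u\prec q_2$ for all $u\in\mathcal S$, and $q_2\prec r$ for every holomorphic $r$ in $\mathbb U$ such that $u\prec r$ for all $u\in\mathcal S$. -/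

import Mathlib

open Set Filter Topology

noncomputable section

namespace DiffSub

/-- The open unit disc. -/
abbrev U : Set ℂ := Metric.ball (0 : ℂ) 1

/-- Holomorphic in the unit disc. Functions are total functions `ℂ → ℂ`; only their values in `U`
matter. -/
def Holo (g : ℂ → ℂ) : Prop := DifferentiableOn ℂ g U

/-- Univalent in the unit disc: holomorphic and injective there. -/
def Univalent (g : ℂ → ℂ) : Prop := Holo g ∧ InjOn g U

/-- Convex function in the unit disc: univalent with convex image. -/
def ConvexFn (g : ℂ → ℂ) : Prop := Univalent g ∧ Convex ℝ (g '' U)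

/-- The class `H[a,n]` of holomorphic functions `a + a_n z^n + a_{n+1} z^{n+1} + ⋯` in `U`. -/
def HClass (a : ℂ) (n : ℕ) : Set (ℂ → ℂ) :=
  {g | Holo g ∧ ∃ c : ℕ → ℂ, ∀ z ∈ U, HasSum (fun k : ℕ => c k * z ^ (n + k)) (g z - a)}

/-- The class `A_p` of holomorphic functions `z^p + a_{p+1} z^{p+1} + ⋯` in `U`. -/
def AClass (p : ℕ) : Set (ℂ → ℂ) :=
  {f | Holo f ∧ ∃ c : ℕ → ℂ, ∀ z ∈ U, HasSum (fun k : ℕ => c k * z ^ (p + 1 + k)) (f z - z ^ p)}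

/-- Subordination `g ≺ h`. -/
def Subordinate (g h : ℂ → ℂ) : Prop :=
  Holo g ∧ Holo h ∧ ∃ ω : ℂ → ℂ, Holo ω ∧ MapsTo ω U U ∧ ω 0 = 0 ∧ ∀ z ∈ U, g z = h (ω z)

/-- The boundary points of the disc at which `g(z) → ∞` as `z → ζ` inside the disc. -/
def exceptionalSet (g : ℂ → ℂ) : Set ℂ :=
  {ζ | ζ ∈ Metric.sphere (0 : ℂ) 1 ∧ Tendsto g (𝓝[U] ζ) (Bornology.cobounded ℂ)}

/-- The class `Q`: `g` extends from `U` to a function `G` that is analytic at every point of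
`closure U \ E(g)` and injective on that set, with `|G'|` bounded below by a positive
constant on `∂U \ E(g)`. -/
def QClass : Set (ℂ → ℂ) :=
  {g | ∃ G : ℂ → ℂ, EqOn G g U ∧
    AnalyticOnNhd ℂ G (Metric.closedBall (0 : ℂ) 1 \ exceptionalSet g) ∧
    InjOn G (Metric.closedBall (0 : ℂ) 1 \ exceptionalSet g) ∧
    ∃ ρ : ℝ, 0 < ρ ∧ ∀ ζ ∈ Metric.sphere (0 : ℂ) 1 \ exceptionalSet g, ρ ≤ ‖deriv G ζ‖}

open Classical in
/-- The function that a formula `g` defines on the whole disc: the holomorphic function on `U` that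
agrees with `g` at all `z ≠ 0` near the origin, if there is one (it is then unique on `U`, see
`holoExt_eqOn`), and `g` itself otherwise (in that case `g` is not holomorphic in `U`). -/
def holoExt (g : ℂ → ℂ) : ℂ → ℂ :=
  if h : ∃ G : ℂ → ℂ, Holo G ∧ ∀ᶠ z in 𝓝[≠] (0 : ℂ), G z = g z then h.choose else g

theorem holoExt_eqOn {g G : ℂ → ℂ} (hG : Holo G) (h : ∀ᶠ z in 𝓝[≠] (0 : ℂ), G z = g z) :
    EqOn (holoExt g) G U := by
  have hex : ∃ G : ℂ → ℂ, Holo G ∧ ∀ᶠ z in 𝓝[≠] (0 : ℂ), G z = g z := ⟨G, hG, h⟩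
  have hdef : holoExt g = hex.choose := dif_pos hex
  obtain ⟨h1, h2⟩ := hex.choose_spec
  rw [hdef]
  have h3 : ∀ᶠ z in 𝓝[≠] (0 : ℂ), hex.choose z = G z := by
    filter_upwards [h, h2] with z hz hz'
    rw [hz, hz']
  exact (h1.analyticOnNhd Metric.isOpen_ball).eqOn_of_preconnected_of_frequently_eq
    (hG.analyticOnNhd Metric.isOpen_ball) (convex_ball (0 : ℂ) 1).isPreconnected
    (Metric.mem_ball_self one_pos) h3.frequently

/-- The expression `[f'(z) / (p z^(p-1))]^η [z^p / f(z)]^μ` with principal powers. For `f ∈ A_p`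
both bases tend to `1` as `z → 0`, so it is holomorphic for small `z ≠ 0`. -/
def opFormula (p : ℕ) (η μ : ℂ) (f : ℂ → ℂ) (z : ℂ) : ℂ :=
  (deriv f z / (p * z ^ (p - 1))) ^ η * (z ^ p / f z) ^ μ

/-- The function `F_p^{η,μ}[f]`, with removable singularities removed (in particular the one at
the origin, where the value is `1`). -/
def opF (p : ℕ) (η μ : ℂ) (f : ℂ → ℂ) : ℂ → ℂ := holoExt (opFormula p η μ f)

/-- The function `Ψ`, with removable singularities removed. -/
def Psi (p : ℕ) (η μ σ γ : ℂ) (f : ℂ → ℂ) : ℂ → ℂ :=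
  holoExt fun z => opFormula p η μ f z *
    (σ + γ * (η * (1 - p + z * deriv (deriv f) z / deriv f z) + μ * (p - z * deriv f z / f z)))

/-- The class `A_0` (for given `p, η, μ`). -/
def AZero (p : ℕ) (η μ : ℂ) : Set (ℂ → ℂ) :=
  {f | f ∈ AClass p ∧ opF p η μ f 0 = 1 ∧ (η, μ) ≠ (0, 0)}

/-- The functions `u` satisfying the differential subordination `ψ(u(z), z u'(z); z) ≺ h(z)`. -/
def subordSolutions (ψ : ℂ → ℂ → ℂ → ℂ) (h : ℂ → ℂ) : Set (ℂ → ℂ) :=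
  {u | Holo u ∧ Subordinate (fun z => ψ (u z) (z * deriv u z) z) h}

/-- The functions `u` satisfying the differential superordination `h(z) ≺ φ(u(z), z u'(z); z)`,
where `u` and `φ(u(z), z u'(z); z)` are required to be univalent. -/
def superordSolutions (φ : ℂ → ℂ → ℂ → ℂ) (h : ℂ → ℂ) : Set (ℂ → ℂ) :=
  {u | Univalent u ∧ Univalent (fun z => φ (u z) (z * deriv u z) z) ∧
    Subordinate h (fun z => φ (u z) (z * deriv u z) z)}

/-- `q` is a dominant of the family `S` of functions. -/
def DominantOf (S : Set (ℂ → ℂ)) (q : ℂ → ℂ) : Prop := Holo q ∧ ∀ u ∈ S, Subordinate u q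

/-- `q` is a subordinant of the family `S` of functions. -/
def SubordinantOf (S : Set (ℂ → ℂ)) (q : ℂ → ℂ) : Prop := Holo q ∧ ∀ u ∈ S, Subordinate q u

/-- A univalent dominant that is subordinate to all dominants. -/
def BestDominantOf (S : Set (ℂ → ℂ)) (q : ℂ → ℂ) : Prop :=
  Univalent q ∧ DominantOf S q ∧ ∀ r, DominantOf S r → Subordinate q r

/-- A univalent subordinant to which all subordinants are subordinate. -/
def BestSubordinantOf (S : Set (ℂ → ℂ)) (q : ℂ → ℂ) : Prop :=
  Univalent q ∧ SubordinantOf S q ∧ ∀ r, SubordinantOf S r → Subordinate r q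

/-- `q` is the best dominant of the differential subordination `ψ(u(z), z u'(z); z) ≺ h(z)`,
in which `h` has to be univalent. -/
def IsBestDominant (ψ : ℂ → ℂ → ℂ → ℂ) (h q : ℂ → ℂ) : Prop :=
  Univalent h ∧ BestDominantOf (subordSolutions ψ h) q

/-- `q` is the best subordinant of the differential superordination
`h(z) ≺ φ(u(z), z u'(z); z)`, in which `h` has to be univalent. -/
def IsBestSubordinant (φ : ℂ → ℂ → ℂ → ℂ) (h q : ℂ → ℂ) : Prop :=
  Univalent h ∧ BestSubordinantOf (superordSolutions φ h) q

/-- The function `σ w + γ v` of `(w, v; z)`. -/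
def linForm (σ γ : ℂ) : ℂ → ℂ → ℂ → ℂ := fun w v _ => σ * w + γ * v

end DiffSub

end

/-!
Near the origin both bases of the powers tend to `1`, and logarithmic differentiation gives
`Ψ = σ F + γ z F'` (`DiffSub.Psi_eqOn`). The claim therefore concerns the operator
`D u = σ u + γ z u'` on holomorphic functions in the disc, with `Re (σ / γ) > 0`.

For a convex function `q` two inequalities carry the argument. The Schwarz lemma shows that `q`
maps every disc `{|x| ≤ |ζ|}` onto a convex set, so `ζ q'(ζ)` is an outer normal of that set at
`q ζ` (`DiffSub.ConvexFn.re_mul_conj_nonneg`). Adding two such inequalities on a circle and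
applying the maximum principle shows that the vector field `q z ↦ z q'(z)` is monotone on the
image of `q` (`DiffSub.ConvexFn.monotone_field`). Since `Re (σ / γ) > 0`, the map
`q z ↦ D q z / γ` is strictly monotone, hence `D q` is univalent; and the points
`σ q z + γ s z q'(z)` are separated from the images under `D q` of `{|x| ≤ |z|}` (for `s ≥ 1`) and
of `{|x| ≥ |z|}` (for `0 ≤ s ≤ 1`), up to `z` itself. In the second case, moving `s` down from `1`
shows that the point stays in the image of `{|x| ≤ |z|}`.

Let `f` be univalent and `g 0 = f 0`. If `g` is not subordinate to `f`, Jack's lemma provides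
points `|z| < |ζ|` and `m ≥ 1` with `g z = f ζ` and `z g'(z) = m ζ f'(ζ)`
(`DiffSub.subordinate_of_no_contact`). With `f = q₂` this contradicts `D g ≺ D q₂`, and with
`g = q₁` it contradicts `D q₁ ≺ D f` when `D f` is univalent, by the preceding facts at the points
`z`, `ζ`. Membership of `F` in the class `Q` enters through the injectivity of `F`.

Finally `q₁` and `q₂` themselves solve both differential relations, because `D q₁ ≺ Ψ ≺ D q₂`; a
subordinant or dominant that belongs to the family is the best one.
-/

namespace DiffSub

open Metric ComplexConjugate

/-! ### Holomorphic and univalent functions -/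

theorem Holo.differentiableAt {g : ℂ → ℂ} (hg : Holo g) {z : ℂ} (hz : z ∈ U) :
    DifferentiableAt ℂ g z :=
  DifferentiableOn.differentiableAt hg (isOpen_ball.mem_nhds hz)

theorem Holo.holo_deriv {g : ℂ → ℂ} (hg : Holo g) : Holo (deriv g) :=
  DifferentiableOn.deriv hg isOpen_ball

theorem zero_mem_U : (0 : ℂ) ∈ U := mem_ball_self one_pos

theorem mem_U_iff {z : ℂ} : z ∈ U ↔ ‖z‖ < 1 := mem_ball_zero_iff

theorem mem_U_of_norm_le {z w : ℂ} (hw : w ∈ U) (h : ‖z‖ ≤ ‖w‖) : z ∈ U :=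
  mem_U_iff.2 (h.trans_lt (mem_U_iff.1 hw))

theorem Univalent.isOpen_image {f : ℂ → ℂ} (hf : Univalent f) {V : Set ℂ} (hV : IsOpen V)
    (hVU : V ⊆ U) : IsOpen (f '' V) := by
  have hpre : IsPreconnected U := (convex_ball (0 : ℂ) 1).isPreconnected
  rcases (hf.1.analyticOnNhd isOpen_ball).is_constant_or_isOpen hpre with ⟨w, hw⟩ | h
  · have h2 : (1 / 2 : ℂ) ∈ U := by rw [mem_U_iff]; norm_num
    have := hf.2 zero_mem_U h2 ((hw _ zero_mem_U).trans (hw _ h2).symm)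
    norm_num at this
  · exact h V hVU hV

/-- The inverse `f '' U → U` of a univalent function `f` (junk outside `f '' U`). -/
noncomputable def discInv (f : ℂ → ℂ) : ℂ → ℂ := Function.invFunOn f U

theorem discInv_mem {f : ℂ → ℂ} {w : ℂ} (hw : w ∈ f '' U) : discInv f w ∈ U :=
  Function.invFunOn_mem hw

theorem apply_discInv {f : ℂ → ℂ} {w : ℂ} (hw : w ∈ f '' U) : f (discInv f w) = w :=
  Function.invFunOn_eq hw

theorem Univalent.discInv_apply {f : ℂ → ℂ} (hf : Univalent f) {z : ℂ} (hz : z ∈ U) :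
    discInv f (f z) = z :=
  hf.2.leftInvOn_invFunOn hz

theorem Univalent.continuousAt_discInv {f : ℂ → ℂ} (hf : Univalent f) {z : ℂ} (hz : z ∈ U) :
    ContinuousAt (discInv f) (f z) := by
  rw [ContinuousAt, hf.discInv_apply hz]
  intro V hV
  obtain ⟨W, hWV, hWo, hzW⟩ := _root_.mem_nhds_iff.1 (inter_mem hV (isOpen_ball.mem_nhds hz))
  rw [mem_map]
  refine mem_of_superset ((hf.isOpen_image hWo fun x hx => (hWV hx).2).mem_nhds
    (mem_image_of_mem f hzW)) ?_
  rintro _ ⟨x, hx, rfl⟩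
  rw [mem_preimage, hf.discInv_apply (hWV hx).2]
  exact (hWV hx).1

/-- The inverse of a univalent function is holomorphic: it is continuous, and differentiable off
the isolated critical values, which are therefore removable. -/
theorem Univalent.differentiableAt_discInv {f : ℂ → ℂ} (hf : Univalent f) {w : ℂ}
    (hw : w ∈ f '' U) : DifferentiableAt ℂ (discInv f) w := by
  obtain ⟨z, hz, rfl⟩ := hw
  have hDo : IsOpen (f '' U) := hf.isOpen_image isOpen_ball subset_rfl
  have hcrit : ∀ x ∈ U, deriv f x ≠ 0 → DifferentiableAt ℂ (discInv f) (f x) := by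
    intro x hx hx'
    refine (HasDerivAt.of_local_left_inverse (f := f) (hf.continuousAt_discInv hx) (f' := deriv f x)
      ?_ hx' ?_).differentiableAt
    · rw [hf.discInv_apply hx]
      exact (hf.1.differentiableAt hx).hasDerivAt
    · filter_upwards [hDo.mem_nhds (mem_image_of_mem f hx)] with y hy using apply_discInv hy
  have hiso : ∀ᶠ x in 𝓝[≠] z, deriv f x ≠ 0 := by
    have han := (hf.1.holo_deriv.analyticOnNhd isOpen_ball) z hz
    rcases han.eventually_eq_zero_or_eventually_ne_zero with h0 | h0
    · -- a function with vanishing derivative near `z` is constant there, hence not injective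
      exfalso
      obtain ⟨r, hr, hr'⟩ := Metric.eventually_nhds_iff_ball.1
        (h0.and (isOpen_ball.eventually_mem hz))
      have hopen := isOpen_ball (x := z) (ε := r)
      have hsub : ball z r ⊆ U := fun x hx => (hr' x hx).2
      have hconst : ∀ x ∈ ball z r, f x = f z := fun x hx =>
        (convex_ball z r).is_const_of_fderivWithin_eq_zero (𝕜 := ℂ) (hf.1.mono hsub)
          (fun y hy => by
            rw [fderivWithin_of_isOpen hopen hy]
            ext
            simpa using (hr' y hy).1) hx (mem_ball_self hr)
      have hmem : z + (r / 2 : ℝ) ∈ ball z r := by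
        rw [mem_ball_iff_norm, add_sub_cancel_left, Complex.norm_real, Real.norm_of_nonneg
          (by positivity)]
        linarith
      have := hf.2 (hsub hmem) hz (hconst _ hmem)
      rw [add_eq_left, Complex.ofReal_eq_zero] at this
      linarith
    · exact h0
  refine (Complex.analyticAt_of_differentiable_on_punctured_nhds_of_continuousAt ?_
    (hf.continuousAt_discInv hz)).differentiableAt
  rw [eventually_nhdsWithin_iff] at hiso ⊢
  have hlim : Tendsto (discInv f) (𝓝 (f z)) (𝓝 z) := by
    simpa [ContinuousAt, hf.discInv_apply hz] using hf.continuousAt_discInv hz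
  filter_upwards [hDo.mem_nhds (mem_image_of_mem f hz), hlim.eventually hiso] with y hy hy' hne
  have := hcrit _ (discInv_mem hy) (hy' fun h => hne ?_)
  · rwa [apply_discInv hy] at this
  · rw [mem_singleton_iff, ← apply_discInv hy, h]

theorem Univalent.hasDerivAt_discInv {f : ℂ → ℂ} (hf : Univalent f) {z : ℂ} (hz : z ∈ U) :
    deriv f z ≠ 0 ∧ HasDerivAt (discInv f) (deriv f z)⁻¹ (f z) := by
  have h1 := (hf.differentiableAt_discInv (mem_image_of_mem f hz)).hasDerivAt
  have h2 := h1.comp z (hf.1.differentiableAt hz).hasDerivAt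
  have h3 : HasDerivAt (discInv f ∘ f) 1 z := (hasDerivAt_id z).congr_of_eventuallyEq <| by
    filter_upwards [isOpen_ball.mem_nhds hz] with x hx using hf.discInv_apply hx
  have h4 := h2.unique h3
  refine ⟨right_ne_zero_of_mul_eq_one h4, ?_⟩
  rwa [eq_inv_of_mul_eq_one_left h4] at h1

theorem Univalent.deriv_ne_zero {f : ℂ → ℂ} (hf : Univalent f) {z : ℂ} (hz : z ∈ U) :
    deriv f z ≠ 0 :=
  (hf.hasDerivAt_discInv hz).1

/-! ### Convex functions -/

theorem nonpos_of_hasDerivAt_of_eventually_le {φ : ℝ → ℝ} {d a : ℝ} (h : HasDerivAt φ d a)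
    (hle : ∀ᶠ t in 𝓝[>] a, φ t ≤ φ a) : d ≤ 0 := by
  have h1 : Tendsto (slope φ a) (𝓝[>] a) (𝓝 d) := (hasDerivAt_iff_tendsto_slope.1 h).mono_left
    (nhdsWithin_mono a fun t (ht : a < t) => ht.ne')
  refine le_of_tendsto h1 ?_
  filter_upwards [hle, self_mem_nhdsWithin] with t ht hat
  rw [slope_def_field]
  exact div_nonpos_of_nonpos_of_nonneg (sub_nonpos.2 ht) (sub_nonneg.2 (le_of_lt hat))

/-- A convex function maps each closed disc centred at the origin onto a convex set; this is
the corresponding statement for segments with an endpoint on the boundary. -/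
theorem ConvexFn.norm_discInv_le {q : ℂ → ℂ} (hq : ConvexFn q) {z ζ : ℂ} (hζ : ζ ∈ U)
    (hz : ‖z‖ ≤ ‖ζ‖) (hζ0 : ζ ≠ 0) {t : ℝ} (ht : t ∈ Icc (0 : ℝ) 1) :
    ‖discInv q (q ζ + t * (q z - q ζ))‖ ≤ ‖ζ‖ := by
  have hle : ∀ x : ℂ, ‖z / ζ * x‖ ≤ ‖x‖ := fun x => by
    rw [norm_mul, norm_div]
    exact mul_le_of_le_one_left (norm_nonneg x) (div_le_one_of_le₀ hz (norm_nonneg ζ))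
  have hmem : ∀ x ∈ U, q x + t * (q (z / ζ * x) - q x) ∈ q '' U := by
    intro x hx
    have := hq.2.add_smul_sub_mem (mem_image_of_mem q hx)
      (mem_image_of_mem q (mem_U_of_norm_le hx (hle x))) ht
    simpa using this
  have h := Complex.norm_le_norm_of_mapsTo_ball
    (f := fun x => discInv q (q x + t * (q (z / ζ * x) - q x))) (z := ζ) (R := 1) ?_ ?_ ?_
    (mem_U_iff.1 hζ)
  · simpa [div_mul_cancel₀ z hζ0] using h
  · intro x hx
    have h1 := hq.1.1.differentiableAt hx
    have h2 : DifferentiableAt ℂ (fun x => q (z / ζ * x)) x :=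
      (hq.1.1.differentiableAt (mem_U_of_norm_le hx (hle x))).comp x
        (f := fun x => z / ζ * x) (by fun_prop)
    exact ((hq.1.differentiableAt_discInv (hmem x hx)).comp x
      (f := fun x => q x + t * (q (z / ζ * x) - q x))
      (h1.add ((h2.sub h1).const_mul (t : ℂ)))).differentiableWithinAt
  · exact fun x hx => ball_subset_closedBall (discInv_mem (hmem x hx))
  · simp [hq.1.discInv_apply zero_mem_U]

/-- The outer normal `ζ q'(ζ)` supports the convex set `q {|z| ≤ |ζ|}` at `q ζ`. -/
theorem ConvexFn.re_mul_conj_nonneg {q : ℂ → ℂ} (hq : ConvexFn q) {z ζ : ℂ} (hζ : ζ ∈ U)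
    (hz : ‖z‖ ≤ ‖ζ‖) : 0 ≤ (ζ * deriv q ζ * conj (q ζ - q z)).re := by
  rcases eq_or_ne ζ 0 with rfl | hζ0
  · simp
  obtain ⟨hne, hinv⟩ := hq.1.hasDerivAt_discInv hζ
  have h1 : HasDerivAt (fun t : ℂ => q ζ + t * (q z - q ζ)) (q z - q ζ) 0 := by
    simpa using ((hasDerivAt_id (0 : ℂ)).mul_const (q z - q ζ)).const_add (q ζ)
  have h2 : HasDerivAt (discInv q) (deriv q ζ)⁻¹ (q ζ + 0 * (q z - q ζ)) := by simpa using hinv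
  have h3 := ((h2.comp (0 : ℂ) h1 : HasDerivAt _ _ _).comp_ofReal (z := 0)).norm_sq
  have h4 := nonpos_of_hasDerivAt_of_eventually_le h3 <| by
    filter_upwards [Ioo_mem_nhdsGT (zero_lt_one (α := ℝ))] with t ht
    have := hq.norm_discInv_le hζ hz hζ0 (t := t) ⟨ht.1.le, ht.2.le⟩
    simp only [Function.comp, Complex.ofReal_zero, zero_mul, add_zero, hq.1.discInv_apply hζ]
    gcongr
  simp only [Function.comp, Complex.ofReal_zero, zero_mul, add_zero, hq.1.discInv_apply hζ,
    Complex.inner] at h4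
  have h5 : ζ * deriv q ζ * conj (q ζ - q z)
      = conj (-((deriv q ζ)⁻¹ * (q z - q ζ) * conj ζ)) * (Complex.normSq (deriv q ζ) : ℝ) := by
    have hne' : conj (deriv q ζ) ≠ 0 := by simpa using hne
    rw [← Complex.mul_conj]
    simp only [map_neg, map_mul, map_sub, map_inv₀, Complex.conj_conj]
    field_simp
    ring
  rw [h5, Complex.re_mul_ofReal, Complex.conj_re, Complex.neg_re]
  exact mul_nonneg (by linarith) (Complex.normSq_nonneg _)

theorem re_div_nonneg_iff {a b : ℂ} (hb : b ≠ 0) : 0 ≤ (a / b).re ↔ 0 ≤ (a * conj b).re := by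
  rw [div_eq_mul_inv, Complex.inv_def, ← mul_assoc, Complex.re_mul_ofReal]
  exact mul_nonneg_iff_of_pos_right (inv_pos.2 (Complex.normSq_pos.2 hb))

/-- The vector field `q z ↦ z q'(z)` on the convex domain `q '' U` is monotone. On a circle
`|z| = |ζ|` this holds because the circle is mapped to a convex curve, and the maximum principle
for `exp (-P)`, where `P` is the quotient of the difference quotients, carries it inside. -/
theorem ConvexFn.monotone_field {q : ℂ → ℂ} (hq : ConvexFn q) {z ζ : ℂ} (hz : z ∈ U)
    (hζ : ζ ∈ U) :
    0 ≤ ((z * deriv q z - ζ * deriv q ζ) * conj (q z - q ζ)).re := by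
  wlog hle : ‖z‖ ≤ ‖ζ‖ generalizing z ζ
  · have := this hζ hz (le_of_not_ge hle)
    rwa [← neg_mul_neg, ← map_neg, neg_sub, neg_sub]
  rcases eq_or_ne z ζ with rfl | hzζ
  · simp
  have hζ0 : ζ ≠ 0 := by
    rintro rfl
    simp at hle
    exact hzζ hle
  set v : ℂ → ℂ := fun x => x * deriv q x with hv
  have hvd : Holo v := differentiableOn_id.mul hq.1.1.holo_deriv
  set P : ℂ → ℂ := fun x => dslope v ζ x / dslope q ζ x with hP
  have hden : ∀ x ∈ U, dslope q ζ x ≠ 0 := by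
    intro x hx
    rcases eq_or_ne x ζ with rfl | hne
    · rw [dslope_same]
      exact hq.1.deriv_ne_zero hx
    · rw [dslope_of_ne _ hne, slope_def_field]
      exact div_ne_zero (sub_ne_zero.2 fun h => hne (hq.1.2 hx hζ h)) (sub_ne_zero.2 hne)
  have hUζ : U ∈ 𝓝 ζ := isOpen_ball.mem_nhds hζ
  have hPd : Holo P := ((Complex.differentiableOn_dslope hUζ).2 hvd).div
    ((Complex.differentiableOn_dslope hUζ).2 hq.1.1) hden
  have hPeq : ∀ x, x ≠ ζ → P x = (v x - v ζ) / (q x - q ζ) := by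
    intro x hne
    simp only [hP, dslope_of_ne _ hne, slope_def_field]
    rw [div_div_div_cancel_right₀ (sub_ne_zero.2 hne)]
  have hne' : ∀ x ∈ U, x ≠ ζ → q x - q ζ ≠ 0 := fun x hx hne =>
    sub_ne_zero.2 fun h => hne (hq.1.2 hx hζ h)
  have hcirc : ∀ x, ‖x‖ = ‖ζ‖ → x ≠ ζ → 0 ≤ (P x).re := by
    intro x hx hne
    have hxU := mem_U_of_norm_le hζ hx.le
    rw [hPeq x hne, re_div_nonneg_iff (hne' x hxU hne)]
    have h1 := hq.re_mul_conj_nonneg hxU hx.ge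
    have h2 := hq.re_mul_conj_nonneg hζ hx.le
    have h3 : (v x - v ζ) * conj (q x - q ζ) =
        x * deriv q x * conj (q x - q ζ) + ζ * deriv q ζ * conj (q ζ - q x) := by
      simp only [hv, map_sub]
      ring
    rw [h3, Complex.add_re]
    exact add_nonneg h1 h2
  have hsphere : ∀ x, ‖x‖ = ‖ζ‖ → 0 ≤ (P x).re := by
    intro x hx
    rcases eq_or_ne x ζ with rfl | hne
    · -- `ζ` is the limit of the points `ζ exp (iθ)`, to which `hcirc` applies
      have hc : ContinuousAt (fun θ : ℝ => (P (x * Complex.exp (θ * Complex.I))).re) 0 := by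
        refine Complex.continuous_re.continuousAt.comp (ContinuousAt.comp (g := P) ?_ ?_)
        · simpa using (hPd.differentiableAt hζ).continuousAt
        · fun_prop
      have hl := hc.tendsto.mono_left (nhdsWithin_le_nhds (s := Ioi 0))
      simp only [Complex.ofReal_zero, zero_mul, Complex.exp_zero, mul_one] at hl
      refine ge_of_tendsto hl ?_
      filter_upwards [Ioo_mem_nhdsGT (zero_lt_one (α := ℝ))] with θ hθ
      refine hcirc _ (by simp [Complex.norm_exp_ofReal_mul_I]) fun h => ?_
      have h1 : Complex.exp (θ * Complex.I) = 1 := mul_left_cancel₀ hζ0 (by rw [h, mul_one])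
      have h2 := congrArg Complex.im h1
      rw [Complex.exp_ofReal_mul_I_im, Complex.one_im] at h2
      exact (Real.sin_pos_of_pos_of_lt_pi hθ.1 (by linarith [hθ.2, Real.pi_gt_three])).ne' h2
    · exact hcirc x hx hne
  have hsub : closedBall (0 : ℂ) ‖ζ‖ ⊆ U := fun x hx =>
    mem_U_of_norm_le hζ (mem_closedBall_zero_iff.1 hx)
  have hmax : ‖Complex.exp (-P z)‖ ≤ 1 := by
    refine Complex.norm_le_of_forall_mem_frontier_norm_le (U := ball (0 : ℂ) ‖ζ‖)
      (f := fun x => Complex.exp (-P x)) isBounded_ball ?_ ?_ ?_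
    · exact DifferentiableOn.diffContOnCl_ball (U := U) (hPd.neg.cexp) hsub
    · intro x hx
      rw [Complex.norm_exp, Complex.neg_re, Real.exp_le_one_iff, neg_nonpos]
      exact hsphere x (mem_sphere_zero_iff_norm.1 (frontier_ball_subset_sphere hx))
    · rw [closure_ball _ (norm_ne_zero_iff.2 hζ0)]
      exact mem_closedBall_zero_iff.2 hle
  rw [Complex.norm_exp, Complex.neg_re, Real.exp_le_one_iff, neg_nonpos, hPeq z hzζ,
    re_div_nonneg_iff (hne' z hz hzζ)] at hmax
  exact hmax

/-! ### Subordination and boundary contact -/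

theorem Subordinate.refl {g : ℂ → ℂ} (hg : Holo g) : Subordinate g g :=
  ⟨hg, hg, id, differentiableOn_id, mapsTo_id _, rfl, fun _ _ => rfl⟩

theorem Subordinate.trans {g h k : ℂ → ℂ} (h₁ : Subordinate g h) (h₂ : Subordinate h k) :
    Subordinate g k := by
  obtain ⟨hg, -, ω, hω, hωU, hω0, hgω⟩ := h₁
  obtain ⟨-, hk, χ, hχ, hχU, hχ0, hhχ⟩ := h₂
  exact ⟨hg, hk, χ ∘ ω, hχ.comp hω hωU, hχU.comp hωU, by simp [hω0, hχ0],
    fun z hz => (hgω z hz).trans (hhχ _ (hωU hz))⟩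

theorem Subordinate.congr_left {g g' h : ℂ → ℂ} (hgh : Subordinate g h) (hg : EqOn g g' U) :
    Subordinate g' h := by
  obtain ⟨h1, h2, ω, hω, hωU, hω0, h3⟩ := hgh
  exact ⟨h1.congr fun z hz => (hg hz).symm, h2, ω, hω, hωU, hω0,
    fun z hz => (hg hz).symm.trans (h3 z hz)⟩

theorem Subordinate.congr_right {g h h' : ℂ → ℂ} (hgh : Subordinate g h) (hh : EqOn h h' U) :
    Subordinate g h' := by
  obtain ⟨h1, h2, ω, hω, hωU, hω0, h3⟩ := hgh
  exact ⟨h1, h2.congr fun z hz => (hh hz).symm, ω, hω, hωU, hω0,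
    fun z hz => (h3 z hz).trans (hh (hωU hz))⟩

theorem Subordinate.apply_zero {g h : ℂ → ℂ} (hgh : Subordinate g h) : g 0 = h 0 := by
  obtain ⟨-, -, ω, -, -, hω0, h3⟩ := hgh
  rw [h3 0 zero_mem_U, hω0]

/-- By the Schwarz lemma, a subordinate function takes at `z` a value that the dominating one
takes in `{|x| ≤ |z|}`. -/
theorem Subordinate.exists_norm_le {g h : ℂ → ℂ} (hgh : Subordinate g h) {z : ℂ} (hz : z ∈ U) :
    ∃ x ∈ U, ‖x‖ ≤ ‖z‖ ∧ g z = h x := by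
  obtain ⟨-, -, ω, hω, hωU, hω0, h3⟩ := hgh
  exact ⟨ω z, hωU hz, Complex.norm_le_norm_of_mapsTo_ball hω
    (fun x hx => ball_subset_closedBall (hωU hx)) hω0 (mem_U_iff.1 hz), h3 z hz⟩

/-- **Jack's lemma**. At a point `z₀` where `|k|` attains its maximum over `{|z| ≤ |z₀|}`, the
logarithmic derivative `z₀ k'(z₀) / k(z₀)` is real and at least `1`. -/
theorem exists_mul_deriv_eq_of_isMax {k : ℂ → ℂ} {z₀ : ℂ}
    (hd : ∀ z ∈ closedBall (0 : ℂ) ‖z₀‖, DifferentiableAt ℂ k z) (hk : k 0 = 0)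
    (hmax : ∀ z ∈ closedBall (0 : ℂ) ‖z₀‖, ‖k z‖ ≤ ‖k z₀‖) (hne : k z₀ ≠ 0) :
    ∃ m : ℝ, 1 ≤ m ∧ z₀ * deriv k z₀ = m * k z₀ := by
  have hz0 : z₀ ≠ 0 := by
    rintro rfl
    exact hne hk
  have hr : 0 < ‖z₀‖ := norm_pos_iff.2 hz0
  have hmem : z₀ ∈ closedBall (0 : ℂ) ‖z₀‖ := by simp
  have hder := (hd z₀ hmem).hasDerivAt
  -- the derivative of `|k|²` along the circle vanishes
  have him : (z₀ * deriv k z₀ * conj (k z₀)).im = 0 := by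
    have h1 : HasDerivAt (fun t : ℂ => z₀ * Complex.exp (t * Complex.I)) (z₀ * Complex.I) 0 := by
      simpa using (((hasDerivAt_id (0 : ℂ)).mul_const Complex.I).cexp.const_mul z₀)
    have h2 : HasDerivAt k (deriv k z₀) (z₀ * Complex.exp (0 * Complex.I)) := by simpa using hder
    have h3 := ((h2.comp (0 : ℂ) h1 : HasDerivAt _ _ _).comp_ofReal (z := 0)).norm_sq
    have h4 : IsLocalMax
        (fun t : ℝ => ‖(k ∘ fun t : ℂ => z₀ * Complex.exp (t * Complex.I)) t‖ ^ 2) 0 := by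
      refine Eventually.of_forall fun t => ?_
      simp only [Function.comp, Complex.ofReal_zero, zero_mul, Complex.exp_zero, mul_one]
      have := hmax (z₀ * Complex.exp (t * Complex.I)) (by
        simp [Complex.norm_exp_ofReal_mul_I])
      gcongr
    have h5 := h4.hasDerivAt_eq_zero h3
    simp only [Function.comp, Complex.ofReal_zero, zero_mul, Complex.exp_zero, mul_one,
      Complex.inner] at h5
    have h6 : deriv k z₀ * (z₀ * Complex.I) * conj (k z₀)
        = z₀ * deriv k z₀ * conj (k z₀) * Complex.I := by ring
    rw [h6, Complex.mul_I_re] at h5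
    linarith
  -- by the Schwarz lemma `|k (t z₀)| ≤ t |k z₀|` for `0 ≤ t ≤ 1`, with equality at `t = 1`
  have hre : ‖k z₀‖ ^ 2 ≤ (z₀ * deriv k z₀ * conj (k z₀)).re := by
    have hS : ∀ t ∈ Ioo (0 : ℝ) 1, ‖k ((1 - t : ℝ) * z₀)‖ ≤ (1 - t) * ‖k z₀‖ := by
      intro t ht
      have ht' : 0 ≤ 1 - t := by linarith [ht.2]
      have hn : ‖((1 - t : ℝ) : ℂ) * z₀‖ = (1 - t) * ‖z₀‖ := by
        rw [norm_mul, Complex.norm_real, Real.norm_of_nonneg ht']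
      have := Complex.dist_le_div_mul_dist_of_mapsTo_ball (f := k) (c := 0) (R₁ := ‖z₀‖)
        (R₂ := ‖k z₀‖) (z := (1 - t : ℝ) * z₀)
        (fun z hz => (hd z (ball_subset_closedBall hz)).differentiableWithinAt)
        (fun z hz => by
          rw [hk]
          exact mem_closedBall_zero_iff.2 (hmax z (ball_subset_closedBall hz)))
        (by
          rw [mem_ball_zero_iff, hn]
          exact mul_lt_of_lt_one_left hr (by linarith [ht.1]))
      rw [hk, dist_zero_right, dist_zero_right, hn] at this
      calc _ ≤ _ := this
        _ = _ := by field_simp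
    have h1 : HasDerivAt (fun t : ℂ => (1 - t) * z₀) (-z₀) 0 := by
      simpa using (((hasDerivAt_id (0 : ℂ)).const_sub 1).mul_const z₀)
    have h2 : HasDerivAt k (deriv k z₀) ((1 - 0) * z₀) := by simpa using hder
    have h3 := ((h2.comp (0 : ℂ) h1 : HasDerivAt _ _ _).comp_ofReal (z := 0)).norm_sq
    have h4 : HasDerivAt (fun t : ℝ => ((1 - t) * ‖k z₀‖) ^ 2) (-2 * ‖k z₀‖ ^ 2) 0 := by
      have := ((((hasDerivAt_id (0 : ℝ)).const_sub 1).mul_const ‖k z₀‖).fun_pow 2)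
      refine this.congr_deriv ?_
      simp only [id, Nat.cast_ofNat, Nat.add_one_sub_one, pow_one, sub_zero]
      ring
    have h5 := nonpos_of_hasDerivAt_of_eventually_le (h3.sub h4) <| by
      filter_upwards [Ioo_mem_nhdsGT (zero_lt_one (α := ℝ))] with t ht
      have h6 := hS t ht
      have h7 : ‖k ((1 - t : ℝ) * z₀)‖ ^ 2 ≤ ((1 - t) * ‖k z₀‖) ^ 2 := by gcongr
      push_cast at h7
      simpa using h7
    simp only [Function.comp, Complex.ofReal_zero, sub_zero, one_mul, Complex.inner] at h5
    have h6 : deriv k z₀ * -z₀ * conj (k z₀) = -(z₀ * deriv k z₀ * conj (k z₀)) := by ring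
    rw [h6, Complex.neg_re] at h5
    linarith
  have hpos : 0 < ‖k z₀‖ ^ 2 := by positivity
  refine ⟨(z₀ * deriv k z₀ * conj (k z₀)).re / ‖k z₀‖ ^ 2, (one_le_div hpos).2 hre, ?_⟩
  have hconj : conj (k z₀) ≠ 0 := by simpa using hne
  refine mul_right_cancel₀ hconj ?_
  have h1 : z₀ * deriv k z₀ * conj (k z₀) = ((z₀ * deriv k z₀ * conj (k z₀)).re : ℂ) :=
    Complex.ext (by simp) (by rw [him, Complex.ofReal_im])
  rw [mul_assoc _ (k z₀), Complex.mul_conj, Complex.normSq_eq_norm_sq, h1, ← Complex.ofReal_mul,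
    Complex.ofReal_re, div_mul_cancel₀ _ hpos.ne']

/-- Criterion for `g ≺ f` with `f` univalent: there is no pair of points at which `g` leaves the
image of a disc under `f` tangentially, with speed ratio `m ≥ 1`. As long as `k = f⁻¹ ∘ g` exists,
Jack's lemma and the hypothesis give `|k(z)| ≤ |z|`, so `g` stays in a compact part of `f '' U`
on every smaller disc and `k` exists everywhere. -/
theorem subordinate_of_no_contact {g f : ℂ → ℂ} (hg : Holo g) (hf : Univalent f)
    (h0 : g 0 = f 0)
    (hno : ∀ z ∈ U, ∀ ζ ∈ U, ∀ m : ℝ, 1 ≤ m → ‖z‖ < ‖ζ‖ → g z = f ζ →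
      z * deriv g z = m * (ζ * deriv f ζ) → False) : Subordinate g f := by
  have hDo : IsOpen (f '' U) := hf.isOpen_image isOpen_ball subset_rfl
  set k : ℂ → ℂ := fun z => discInv f (g z) with hk
  have hk0 : k 0 = 0 := by simp only [hk, h0, hf.discInv_apply zero_mem_U]
  have hkd : ∀ z ∈ U, g z ∈ f '' U → DifferentiableAt ℂ k z := fun z hz hgz =>
    (hf.differentiableAt_discInv hgz).comp z (hg.differentiableAt hz)
  -- an a priori bound on discs on which `k` exists
  have hbound : ∀ z ∈ U, (∀ x, ‖x‖ ≤ ‖z‖ → g x ∈ f '' U) → ‖k z‖ ≤ ‖z‖ := by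
    intro z hz hzD
    have hsub : ∀ x, ‖x‖ ≤ ‖z‖ → x ∈ U := fun x hx => mem_U_of_norm_le hz hx
    obtain ⟨w, hw, hwmax⟩ := (isCompact_closedBall (0 : ℂ) ‖z‖).exists_isMaxOn
      ⟨z, by simp⟩ (f := fun x => ‖k x‖) (fun x hx => by
        have hx' := mem_closedBall_zero_iff.1 hx
        exact (hkd x (hsub x hx') (hzD x hx')).continuousAt.norm.continuousWithinAt)
    have hwz := mem_closedBall_zero_iff.1 hw
    by_contra! hlt
    have hlt' : ‖w‖ < ‖k w‖ := hwz.trans_lt (hlt.trans_le (hwmax (by simp)))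
    have hgw := hzD w hwz
    have hwU := hsub w hwz
    obtain ⟨m, hm, hm'⟩ := exists_mul_deriv_eq_of_isMax (k := k) (z₀ := w)
      (fun x hx => by
        have hx' := (mem_closedBall_zero_iff.1 hx).trans hwz
        exact hkd x (hsub x hx') (hzD x hx')) hk0
      (fun x hx => hwmax (mem_closedBall_zero_iff.2
        ((mem_closedBall_zero_iff.1 hx).trans hwz)))
      (norm_pos_iff.1 ((norm_nonneg w).trans_lt hlt'))
    have hkU : k w ∈ U := discInv_mem hgw
    have hfk : f (k w) = g w := apply_discInv hgw
    refine hno w hwU (k w) hkU m hm hlt' hfk.symm ?_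
    have hev : g =ᶠ[𝓝 w] f ∘ k := by
      filter_upwards [(hg.differentiableAt hwU).continuousAt.preimage_mem_nhds
        (hDo.mem_nhds hgw)] with x hx using (apply_discInv hx).symm
    have hchain : deriv g w = deriv f (k w) * deriv k w := by
      rw [hev.deriv_eq]
      exact ((hf.1.differentiableAt hkU).hasDerivAt.comp w (hkd w hwU hgw).hasDerivAt).deriv
    rw [hchain]
    linear_combination deriv f (k w) * hm'
  have hall : ∀ z ∈ U, g z ∈ f '' U := by
    by_contra! hcon
    obtain ⟨z₁, hz₁, hgz₁⟩ := hcon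
    -- a point of least modulus that `g` maps out of `f '' U`
    have hcl : IsCompact (closedBall (0 : ℂ) ‖z₁‖ ∩ g ⁻¹' (f '' U)ᶜ) := by
      refine (isCompact_closedBall (0 : ℂ) ‖z₁‖).of_isClosed_subset ?_ inter_subset_left
      exact ContinuousOn.preimage_isClosed_of_isClosed
        (hg.continuousOn.mono fun x hx => mem_U_of_norm_le hz₁ (mem_closedBall_zero_iff.1 hx))
        isClosed_closedBall hDo.isClosed_compl
    obtain ⟨z₂, ⟨hz₂, hgz₂⟩, hmin⟩ := hcl.exists_isMinOn ⟨z₁, by simp, hgz₁⟩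
      (f := fun x => ‖x‖) continuous_norm.continuousOn
    have hz₂' := mem_closedBall_zero_iff.1 hz₂
    have hz₂U := mem_U_of_norm_le hz₁ hz₂'
    have hlt : ∀ x, ‖x‖ < ‖z₂‖ → g x ∈ f '' U := by
      intro x hx
      by_contra hgx
      exact absurd (hmin ⟨mem_closedBall_zero_iff.2 (hx.le.trans hz₂'), hgx⟩) (not_le.2 hx)
    have hz₂0 : z₂ ≠ 0 := by
      rintro rfl
      exact hgz₂ (by rw [h0]; exact mem_image_of_mem f zero_mem_U)
    have hsub : closedBall (0 : ℂ) ‖z₂‖ ⊆ U := fun x hx =>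
      mem_U_of_norm_le hz₂U (mem_closedBall_zero_iff.1 hx)
    have hcomp : IsClosed (f '' closedBall (0 : ℂ) ‖z₂‖) :=
      ((isCompact_closedBall (0 : ℂ) ‖z₂‖).image_of_continuousOn
        (hf.1.continuousOn.mono hsub)).isClosed
    have hball : ball (0 : ℂ) ‖z₂‖ ⊆ g ⁻¹' (f '' closedBall (0 : ℂ) ‖z₂‖) := by
      intro x hx
      have hx' := mem_ball_zero_iff.1 hx
      have hb := hbound x (hsub (ball_subset_closedBall hx)) fun y hy => hlt y (hy.trans_lt hx')
      exact ⟨k x, mem_closedBall_zero_iff.2 (hb.trans hx'.le), apply_discInv (hlt x hx')⟩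
    have hmem : z₂ ∈ closure (ball (0 : ℂ) ‖z₂‖) := by
      rw [closure_ball _ (norm_ne_zero_iff.2 hz₂0)]
      simp
    have h1 : g z₂ ∈ f '' closedBall (0 : ℂ) ‖z₂‖ := by
      have h2 : g z₂ ∈ closure (f '' closedBall (0 : ℂ) ‖z₂‖) :=
        (hg.differentiableAt hz₂U).continuousAt.continuousWithinAt.mem_closure hmem hball
      rwa [hcomp.closure_eq] at h2
    exact hgz₂ (image_mono hsub h1)
  exact ⟨hg, hf.1, k, fun z hz => (hkd z hz (hall z hz)).differentiableWithinAt,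
    fun z hz => discInv_mem (hall z hz), hk0, fun z hz => (apply_discInv (hall z hz)).symm⟩

/-! ### The first-order operator `q ↦ σ q + γ z q'` -/

theorem Holo.linear_field {g : ℂ → ℂ} (hg : Holo g) (σ γ : ℂ) :
    Holo fun z => σ * g z + γ * (z * deriv g z) :=
  (DifferentiableOn.const_mul hg σ).add
    ((differentiableOn_id.mul (Holo.holo_deriv hg)).const_mul γ)

/-- The operator is strictly monotone in the variable `q z`, since `Re (σ / γ) > 0`. -/
theorem ConvexFn.eq_of_linear_field_eq {q : ℂ → ℂ} (hq : ConvexFn q) {σ γ : ℂ} (hγ : γ ≠ 0)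
    (hσγ : 0 < (σ / γ).re) {x z : ℂ} (hx : x ∈ U) (hz : z ∈ U) {s : ℝ}
    (h : σ * q x + γ * (x * deriv q x) = σ * q z + γ * (s * (z * deriv q z)))
    (hnn : 0 ≤ ((x * deriv q x - s * (z * deriv q z)) * conj (q x - q z)).re) : x = z := by
  by_contra hne
  have hΔ : q x - q z ≠ 0 := sub_ne_zero.2 fun h' => hne (hq.1.2 hx hz h')
  have h1 : σ / γ * (q x - q z) + (x * deriv q x - s * (z * deriv q z)) = 0 := by
    field_simp
    linear_combination h
  have h2 : σ / γ * (Complex.normSq (q x - q z) : ℝ)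
      + (x * deriv q x - s * (z * deriv q z)) * conj (q x - q z) = 0 := by
    rw [← Complex.mul_conj]
    linear_combination conj (q x - q z) * h1
  have h3 := congrArg Complex.re h2
  rw [Complex.add_re, Complex.re_mul_ofReal, Complex.zero_re] at h3
  have := mul_pos hσγ (Complex.normSq_pos.2 hΔ)
  linarith

theorem ConvexFn.univalent_linear_field {q : ℂ → ℂ} (hq : ConvexFn q) {σ γ : ℂ} (hγ : γ ≠ 0)
    (hσγ : 0 < (σ / γ).re) : Univalent fun z => σ * q z + γ * (z * deriv q z) :=
  ⟨hq.1.1.linear_field σ γ, fun x hx z hz h => hq.eq_of_linear_field_eq hγ hσγ hx hz (s := 1)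
    (by simpa using h) (by simpa using hq.monotone_field hx hz)⟩

/-- For `m ≥ 1` the point `σ q z + γ m z q'(z)` lies outside the image of `{|x| ≤ |z|}` under
`σ q + γ z q'`, except for `z` itself. -/
theorem ConvexFn.eq_of_one_le {q : ℂ → ℂ} (hq : ConvexFn q) {σ γ : ℂ} (hγ : γ ≠ 0)
    (hσγ : 0 < (σ / γ).re) {x z : ℂ} (hz : z ∈ U) (hxz : ‖x‖ ≤ ‖z‖) {m : ℝ} (hm : 1 ≤ m)
    (h : σ * q x + γ * (x * deriv q x) = σ * q z + γ * (m * (z * deriv q z))) : x = z := by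
  have hx := mem_U_of_norm_le hz hxz
  refine hq.eq_of_linear_field_eq hγ hσγ hx hz h ?_
  have h1 := hq.monotone_field hx hz
  have h2 := mul_nonneg (sub_nonneg.2 hm) (hq.re_mul_conj_nonneg hz hxz)
  rw [← Complex.re_ofReal_mul] at h2
  have h3 : (x * deriv q x - m * (z * deriv q z)) * conj (q x - q z)
      = (x * deriv q x - z * deriv q z) * conj (q x - q z)
        + ((m - 1 : ℝ) : ℂ) * (z * deriv q z * conj (q z - q x)) := by
    push_cast
    simp only [map_sub]
    ring
  rw [h3, Complex.add_re]
  exact add_nonneg h1 h2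

/-- For `0 ≤ τ ≤ 1` the point `σ q z + γ τ z q'(z)` is not taken by `σ q + γ z q'` in
`{|x| ≥ |z|}`, except at `z` itself. -/
theorem ConvexFn.eq_of_le_one {q : ℂ → ℂ} (hq : ConvexFn q) {σ γ : ℂ} (hγ : γ ≠ 0)
    (hσγ : 0 < (σ / γ).re) {x z : ℂ} (hx : x ∈ U) (hzx : ‖z‖ ≤ ‖x‖) {τ : ℝ}
    (hτ : τ ∈ Icc (0 : ℝ) 1)
    (h : σ * q x + γ * (x * deriv q x) = σ * q z + γ * (τ * (z * deriv q z))) : x = z := by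
  have hz := mem_U_of_norm_le hx hzx
  refine hq.eq_of_linear_field_eq hγ hσγ hx hz h ?_
  have h1 := mul_nonneg hτ.1 (hq.monotone_field hx hz)
  have h2 := mul_nonneg (sub_nonneg.2 hτ.2) (hq.re_mul_conj_nonneg hx hzx)
  rw [← Complex.re_ofReal_mul] at h1 h2
  have h3 : (x * deriv q x - τ * (z * deriv q z)) * conj (q x - q z)
      = (τ : ℂ) * ((x * deriv q x - z * deriv q z) * conj (q x - q z))
        + ((1 - τ : ℝ) : ℂ) * (x * deriv q x * conj (q x - q z)) := by
    push_cast
    ring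
  rw [h3, Complex.add_re]
  exact add_nonneg h1 h2

/-- For `0 ≤ τ ≤ 1` the point `σ q z + γ τ z q'(z)` lies in the image of `{|x| ≤ |z|}` under
`σ q + γ z q'`. This is clear for `τ = 1`; by `ConvexFn.eq_of_le_one` the set of admissible `τ` is
both open and closed. -/
theorem ConvexFn.exists_linear_field_eq {q : ℂ → ℂ} (hq : ConvexFn q) {σ γ : ℂ} (hγ : γ ≠ 0)
    (hσγ : 0 < (σ / γ).re) {z : ℂ} (hz : z ∈ U) {τ : ℝ} (hτ : τ ∈ Icc (0 : ℝ) 1) :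
    ∃ x ∈ U, ‖x‖ ≤ ‖z‖ ∧
      σ * q x + γ * (x * deriv q x) = σ * q z + γ * (τ * (z * deriv q z)) := by
  set h : ℂ → ℂ := fun x => σ * q x + γ * (x * deriv q x) with hh
  have hu : Univalent h := hq.univalent_linear_field hγ hσγ
  set l : ℝ → ℂ := fun t => σ * q z + γ * (t * (z * deriv q z)) with hl
  have hlc : Continuous l := by fun_prop
  have hsub : closedBall (0 : ℂ) ‖z‖ ⊆ U := fun x hx =>
    mem_U_of_norm_le hz (mem_closedBall_zero_iff.1 hx)
  have hclosed : IsClosed (h '' closedBall (0 : ℂ) ‖z‖) :=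
    ((isCompact_closedBall (0 : ℂ) ‖z‖).image_of_continuousOn
      (hu.1.continuousOn.mono hsub)).isClosed
  have hopen : IsOpen (h '' U) := hu.isOpen_image isOpen_ball subset_rfl
  have hkey : ∀ t ∈ Icc (0 : ℝ) 1, l t ∈ h '' U → l t ∈ h '' closedBall (0 : ℂ) ‖z‖ := by
    rintro t ht ⟨x, hx, hxt⟩
    refine ⟨x, mem_closedBall_zero_iff.2 ?_, hxt⟩
    by_contra! hlt
    rw [hq.eq_of_le_one hγ hσγ hx hlt.le ht hxt] at hlt
    exact lt_irrefl _ hlt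
  have hconn : Icc (0 : ℝ) 1 ⊆ l ⁻¹' (h '' U) := by
    have h1 : (1 : ℝ) ∈ l ⁻¹' (h '' closedBall (0 : ℂ) ‖z‖) := ⟨z, by simp, by simp [hh, hl]⟩
    refine (isPreconnected_iff_subset_of_disjoint.1 isPreconnected_Icc _ _ (hopen.preimage hlc)
      (hclosed.isOpen_compl.preimage hlc) ?_ ?_).resolve_right fun h2 => ?_
    · intro t _
      by_cases ht' : l t ∈ h '' U
      · exact Or.inl ht'
      · exact Or.inr fun h3 => ht' (image_mono hsub h3)
    · exact eq_empty_of_forall_notMem fun t ht => ht.2.2 (hkey t ht.1 ht.2.1)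
    · exact h2 (right_mem_Icc.2 zero_le_one) h1
  obtain ⟨x, hx, hxτ⟩ := hkey τ hτ (hconn hτ)
  exact ⟨x, hsub hx, mem_closedBall_zero_iff.1 hx, hxτ⟩

/-! ### Differential subordination and superordination -/

/-- At a contact point the hypothesis gives `σ q ζ + γ m ζ q'(ζ)` as a value of `σ q + γ z q'` in
`{|x| ≤ |z|}` with `|z| < |ζ|`, against `ConvexFn.eq_of_one_le`. -/
theorem ConvexFn.subordinate_of_linear_field {q g : ℂ → ℂ} (hq : ConvexFn q) {σ γ : ℂ}
    (hγ : γ ≠ 0) (hσγ : 0 < (σ / γ).re) (hg : Holo g)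
    (h : Subordinate (fun z => σ * g z + γ * (z * deriv g z))
      (fun z => σ * q z + γ * (z * deriv q z))) : Subordinate g q := by
  have hσ : σ ≠ 0 := by
    rintro rfl
    simp at hσγ
  refine subordinate_of_no_contact hg hq.1 ?_ ?_
  · simpa [hσ] using h.apply_zero
  · intro z hz ζ hζ m hm hlt hgz hdz
    obtain ⟨x, -, hxz, hx⟩ := h.exists_norm_le hz
    have hxζ : x = ζ := hq.eq_of_one_le hγ hσγ hζ (hxz.trans hlt.le) hm (by
      rw [← hdz, ← hgz]
      exact hx.symm)
    rw [hxζ] at hxz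
    exact absurd hxz (not_le.2 hlt)

/-- At a contact point the value of `σ g + γ z g'` at `ζ` is also taken in `{|x| ≤ |z|}`, by
`ConvexFn.exists_linear_field_eq` and the hypothesis, against injectivity. -/
theorem ConvexFn.subordinate_of_linear_field_superordinate {q g : ℂ → ℂ} (hq : ConvexFn q)
    {σ γ : ℂ} (hγ : γ ≠ 0) (hσγ : 0 < (σ / γ).re) (hg : Univalent g)
    (hΦ : Univalent fun z => σ * g z + γ * (z * deriv g z))
    (h : Subordinate (fun z => σ * q z + γ * (z * deriv q z))
      (fun z => σ * g z + γ * (z * deriv g z))) : Subordinate q g := by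
  have hσ : σ ≠ 0 := by
    rintro rfl
    simp at hσγ
  refine subordinate_of_no_contact hq.1.1 hg ?_ ?_
  · simpa [hσ] using h.apply_zero
  · intro z hz ζ hζ m hm hlt hqz hdz
    -- the value at `ζ` of `σ g + γ z g'` is `σ q z + γ m⁻¹ z q'(z)`
    have hm0 : (0 : ℝ) < m := by linarith
    obtain ⟨x, hxU, hxz, hx⟩ := hq.exists_linear_field_eq hγ hσγ hz (τ := m⁻¹)
      ⟨by positivity, inv_le_one_of_one_le₀ hm⟩
    obtain ⟨y, hyU, hyx, hy⟩ := h.exists_norm_le hxU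
    have hyζ : y = ζ := hΦ.2 hyU hζ <| by
      have hmc : (m : ℂ) ≠ 0 := by exact_mod_cast hm0.ne'
      refine hy.symm.trans (hx.trans ?_)
      rw [hdz, hqz, Complex.ofReal_inv, inv_mul_cancel_left₀ hmc]
    rw [hyζ] at hyx
    exact absurd (hyx.trans hxz) (not_le.2 hlt)

/-! ### The functions `F` and `Ψ` -/

/-- A function of the class `A_p` has the form `z ^ p A(z)` near the origin, with `A` analytic and
`A(0) = 1`. -/
theorem AClass.exists_eq_pow_mul {p : ℕ} {f : ℂ → ℂ} (hf : f ∈ AClass p) :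
    ∃ A : ℂ → ℂ, AnalyticAt ℂ A 0 ∧ A 0 = 1 ∧ ∀ᶠ z in 𝓝 (0 : ℂ), f z = z ^ p * A z := by
  obtain ⟨-, c, hc⟩ := hf
  set C : ℂ → ℂ := fun z => ∑' k, c k * z ^ k with hC
  have hsum : ∀ z ∈ U, HasSum (fun k => c k * z ^ k) (C z) := by
    intro z hz
    refine Summable.hasSum ?_
    rcases eq_or_ne z 0 with rfl | hz0
    · refine summable_of_ne_finset_zero (s := {0}) fun k hk => ?_
      simp only [Finset.mem_singleton] at hk
      simp [hk]
    · refine ((hc z hz).summable.mul_left (z ^ (p + 1))⁻¹).congr fun k => ?_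
      have : z ^ (p + 1) ≠ 0 := pow_ne_zero _ hz0
      rw [pow_add z (p + 1) k]
      field_simp
  have hCa : AnalyticAt ℂ C 0 := by
    refine ⟨FormalMultilinearSeries.ofScalars ℂ c, hasFPowerSeriesAt_iff.2 ?_⟩
    filter_upwards [isOpen_ball.mem_nhds zero_mem_U] with z hz
    simpa [FormalMultilinearSeries.coeff_ofScalars, mul_comm] using hsum z hz
  refine ⟨fun z => 1 + z * C z, by fun_prop, by simp, ?_⟩
  filter_upwards [isOpen_ball.mem_nhds zero_mem_U] with z hz
  have h1 : HasSum (fun k => c k * z ^ (p + 1 + k)) (z ^ (p + 1) * C z) := by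
    refine ((hsum z hz).mul_left (z ^ (p + 1))).congr_fun fun k => ?_
    ring
  have h2 := (hc z hz).unique h1
  linear_combination h2

/-- Both bases in `opFormula` tend to `1` at the origin. -/
theorem AClass.tendsto_bases {p : ℕ} (hp : 1 ≤ p) {f : ℂ → ℂ} (hf : f ∈ AClass p) :
    Tendsto (fun z => deriv f z / (p * z ^ (p - 1))) (𝓝[≠] 0) (𝓝 1) ∧
      Tendsto (fun z => z ^ p / f z) (𝓝[≠] 0) (𝓝 1) := by
  obtain ⟨A, hA, hA0, hfA⟩ := AClass.exists_eq_pow_mul hf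
  obtain ⟨n, rfl⟩ : ∃ n, p = n + 1 := ⟨p - 1, by omega⟩
  have hn : ((n : ℂ) + 1) ≠ 0 := by exact_mod_cast n.succ_ne_zero
  constructor
  · have hlim : Tendsto (fun z => A z + z * deriv A z / (n + 1)) (𝓝[≠] 0) (𝓝 1) := by
      have hc : ContinuousAt (fun z => A z + z * deriv A z / (n + 1)) 0 :=
        hA.continuousAt.add ((continuousAt_id.mul hA.deriv.continuousAt).div_const _)
      have := hc.tendsto
      simp only [hA0, zero_mul, zero_div, add_zero] at this
      exact this.mono_left nhdsWithin_le_nhds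
    refine hlim.congr' ?_
    filter_upwards [nhdsWithin_le_nhds hfA.eventually_nhds,
      nhdsWithin_le_nhds hA.eventually_analyticAt, self_mem_nhdsWithin] with z hz hAz hz0
    have hz0' : z ^ n ≠ 0 := pow_ne_zero _ hz0
    have h1 := ((hasDerivAt_pow (n + 1) z).mul hAz.differentiableAt.hasDerivAt).deriv
    have h2 : f =ᶠ[𝓝 z] (fun z => z ^ (n + 1)) * A := hz
    rw [h2.deriv_eq, h1]
    push_cast
    field_simp
    ring
  · have hlim : Tendsto (fun z => (A z)⁻¹) (𝓝[≠] 0) (𝓝 1) := by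
      have := hA.continuousAt.tendsto.inv₀ (by rw [hA0]; exact one_ne_zero)
      rw [hA0, inv_one] at this
      exact this.mono_left nhdsWithin_le_nhds
    refine hlim.congr' ?_
    filter_upwards [nhdsWithin_le_nhds hfA, self_mem_nhdsWithin] with z hz hz0
    have hz0' : z ^ (n + 1) ≠ 0 := pow_ne_zero _ hz0
    rw [hz, div_mul_eq_div_div, div_self hz0', one_div]

theorem hasDerivAt_pow_of_ne_zero (n : ℕ) {z : ℂ} (hz : z ≠ 0) :
    HasDerivAt (fun x : ℂ => x ^ n) (n * z ^ n / z) z := by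
  refine (hasDerivAt_pow n z).congr_deriv ?_
  rcases n with - | n
  · simp
  · rw [Nat.add_sub_cancel, pow_succ]
    field_simp

theorem hasDerivAt_cpow_const_of_mem_slitPlane {a : ℂ → ℂ} {a' z : ℂ} (c : ℂ)
    (ha : HasDerivAt a a' z) (hz : a z ∈ Complex.slitPlane) :
    HasDerivAt (fun x => a x ^ c) (a z ^ c * (c * (a' / a z))) z := by
  refine (ha.cpow_const hz).congr_deriv ?_
  rw [Complex.cpow_sub _ _ (Complex.slitPlane_ne_zero hz), Complex.cpow_one]
  ring

/-- Logarithmic differentiation of `opFormula`. -/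
theorem hasDerivAt_opFormula {p : ℕ} (hp : 1 ≤ p) (η μ : ℂ) {f : ℂ → ℂ} (hf : Holo f) {z : ℂ}
    (hz : z ∈ U) (hz0 : z ≠ 0) (h1 : deriv f z / (p * z ^ (p - 1)) ∈ Complex.slitPlane)
    (h2 : z ^ p / f z ∈ Complex.slitPlane) :
    HasDerivAt (opFormula p η μ f) (opFormula p η μ f z *
      ((η * (1 - p + z * deriv (deriv f) z / deriv f z) + μ * (p - z * deriv f z / f z)) / z))
      z := by
  obtain ⟨n, rfl⟩ : ∃ n, p = n + 1 := ⟨p - 1, by omega⟩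
  have hn : ((n + 1 : ℕ) : ℂ) ≠ 0 := by exact_mod_cast n.succ_ne_zero
  simp only [Nat.add_sub_cancel] at h1
  have hf' : deriv f z ≠ 0 := fun h => Complex.slitPlane_ne_zero h1 (by rw [h, zero_div])
  have hf0 : f z ≠ 0 := fun h => Complex.slitPlane_ne_zero h2 (by rw [h, div_zero])
  have hzn : z ^ n ≠ 0 := pow_ne_zero n hz0
  have hzn' : z ^ (n + 1) ≠ 0 := pow_ne_zero _ hz0
  have d1 := (hf.holo_deriv.differentiableAt hz).hasDerivAt.div
    ((hasDerivAt_pow_of_ne_zero n hz0).const_mul ((n + 1 : ℕ) : ℂ)) (mul_ne_zero hn hzn)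
  have d2 := (hasDerivAt_pow_of_ne_zero (n + 1) hz0).div (hf.differentiableAt hz).hasDerivAt hf0
  have d3 := (hasDerivAt_cpow_const_of_mem_slitPlane η d1 h1).mul
    (hasDerivAt_cpow_const_of_mem_slitPlane μ d2 h2)
  refine d3.congr_deriv ?_
  have e1 : (deriv (deriv f) z * ((n + 1 : ℕ) * z ^ n)
      - deriv f z * ((n + 1 : ℕ) * (n * z ^ n / z))) / ((n + 1 : ℕ) * z ^ n) ^ 2
      / (deriv f z / ((n + 1 : ℕ) * z ^ n))
      = (1 - (n + 1 : ℕ) + z * deriv (deriv f) z / deriv f z) / z := by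
    field_simp
    push_cast
    ring
  have e2 : ((n + 1 : ℕ) * z ^ (n + 1) / z * f z - z ^ (n + 1) * deriv f z) / f z ^ 2
      / (z ^ (n + 1) / f z) = ((n + 1 : ℕ) - z * deriv f z / f z) / z := by
    field_simp
  simp only [opFormula, Pi.div_apply, Nat.add_sub_cancel, e1, e2]
  ring

theorem eventually_holoExt_eq (g : ℂ → ℂ) :
    ∀ᶠ z in 𝓝[≠] (0 : ℂ), holoExt g z = g z := by
  by_cases h : ∃ G : ℂ → ℂ, Holo G ∧ ∀ᶠ z in 𝓝[≠] (0 : ℂ), G z = g z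
  · have hdef : holoExt g = h.choose := dif_pos h
    rw [hdef]
    exact h.choose_spec.2
  · have hdef : holoExt g = g := dif_neg h
    exact Eventually.of_forall fun z => by rw [hdef]

/-- If `F` is holomorphic in the disc, then `Ψ = σ F + γ z F'`. -/
theorem Psi_eqOn {p : ℕ} (hp : 1 ≤ p) {η μ : ℂ} (σ γ : ℂ) {f : ℂ → ℂ} (hf : f ∈ AClass p)
    (hF : Holo (opF p η μ f)) :
    EqOn (Psi p η μ σ γ f)
      (fun z => σ * opF p η μ f z + γ * (z * deriv (opF p η μ f) z)) U := by
  refine holoExt_eqOn (hF.linear_field σ γ) ?_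
  obtain ⟨h1, h2⟩ := AClass.tendsto_bases hp hf
  have hslit : Complex.slitPlane ∈ 𝓝 (1 : ℂ) :=
    Complex.isOpen_slitPlane.mem_nhds Complex.one_mem_slitPlane
  have hE : ∀ᶠ z in 𝓝[≠] (0 : ℂ), opF p η μ f z = opFormula p η μ f z :=
    eventually_holoExt_eq _
  have hE' : ∀ᶠ z in 𝓝[≠] (0 : ℂ), opF p η μ f =ᶠ[𝓝 z] opFormula p η μ f := by
    filter_upwards [eventually_eventually_nhdsWithin.2 hE, self_mem_nhdsWithin] with z hz hz0
    rwa [isOpen_compl_singleton.nhdsWithin_eq hz0] at hz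
  filter_upwards [h1 hslit, h2 hslit, hE', self_mem_nhdsWithin,
    nhdsWithin_le_nhds (isOpen_ball.mem_nhds zero_mem_U)] with z ha hb hz hz0 hzU
  rw [hz.deriv_eq, hz.eq_of_nhds, (hasDerivAt_opFormula hp η μ hf.1 hzU hz0 ha hb).deriv]
  have hz0' : z ≠ 0 := hz0
  field_simp

/-! ### Best dominants and best subordinants -/

theorem bestSubordinantOf_of_mem {S : Set (ℂ → ℂ)} {q : ℂ → ℂ} (hq : Univalent q) (hqS : q ∈ S)
    (h : ∀ u ∈ S, Subordinate q u) : BestSubordinantOf S q :=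
  ⟨hq, ⟨hq.1, h⟩, fun _ hr => hr.2 q hqS⟩

theorem bestDominantOf_of_mem {S : Set (ℂ → ℂ)} {q : ℂ → ℂ} (hq : Univalent q) (hqS : q ∈ S)
    (h : ∀ u ∈ S, Subordinate u q) : BestDominantOf S q :=
  ⟨hq, ⟨hq.1, h⟩, fun _ hr => hr.2 q hqS⟩

/-- Members of the class `Q` are univalent, since no exceptional point lies in the open disc. -/
theorem univalent_of_mem_QClass {g : ℂ → ℂ} (hg : Holo g) (hQ : g ∈ QClass) : Univalent g := by
  obtain ⟨G, hGg, -, hinj, -⟩ := hQ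
  have hsub : U ⊆ closedBall (0 : ℂ) 1 \ exceptionalSet g := fun z hz =>
    ⟨ball_subset_closedBall hz, fun h => sphere_disjoint_ball.ne_of_mem h.1 hz rfl⟩
  exact ⟨hg, (hinj.mono hsub).congr hGg⟩

end DiffSub

theorem mainTheorem4 (p : ℕ) (hp : 1 ≤ p) (η μ σ γ : ℂ) (hγ : γ ≠ 0) (hσγ : 0 < (σ / γ).re)
    (q₁ q₂ f : ℂ → ℂ)
    (hq₁ : DiffSub.ConvexFn q₁) (hq₂ : DiffSub.ConvexFn q₂) (hq₁0 : q₁ 0 = 1) (hq₂0 : q₂ 0 = 1)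
    (hf : f ∈ DiffSub.AZero p η μ)
    (hF : DiffSub.opF p η μ f ∈ DiffSub.HClass 1 1 ∩ DiffSub.QClass)
    (hΨ : DiffSub.Univalent (DiffSub.Psi p η μ σ γ f))
    (h₁ : DiffSub.Subordinate (fun z => σ * q₁ z + γ * (z * deriv q₁ z))
      (DiffSub.Psi p η μ σ γ f))
    (h₂ : DiffSub.Subordinate (DiffSub.Psi p η μ σ γ f)
      (fun z => σ * q₂ z + γ * (z * deriv q₂ z))) :
    DiffSub.Subordinate q₁ (DiffSub.opF p η μ f) ∧
    DiffSub.Subordinate (DiffSub.opF p η μ f) q₂ ∧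
    DiffSub.IsBestSubordinant (DiffSub.linForm σ γ)
      (fun z => σ * q₁ z + γ * (z * deriv q₁ z)) q₁ ∧
    DiffSub.IsBestDominant (DiffSub.linForm σ γ)
      (fun z => σ * q₂ z + γ * (z * deriv q₂ z)) q₂ ∧
    DiffSub.BestSubordinantOf
      (DiffSub.superordSolutions (DiffSub.linForm σ γ)
          (fun z => σ * q₁ z + γ * (z * deriv q₁ z)) ∩
        DiffSub.subordSolutions (DiffSub.linForm σ γ)
          (fun z => σ * q₂ z + γ * (z * deriv q₂ z))) q₁ ∧
    DiffSub.BestDominantOf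
      (DiffSub.superordSolutions (DiffSub.linForm σ γ)
          (fun z => σ * q₁ z + γ * (z * deriv q₁ z)) ∩
        DiffSub.subordSolutions (DiffSub.linForm σ γ)
          (fun z => σ * q₂ z + γ * (z * deriv q₂ z))) q₂ := by
  have hFh : DiffSub.Holo (DiffSub.opF p η μ f) := hF.1.1
  have hΨF := DiffSub.Psi_eqOn hp σ γ hf.1 hFh
  have hΦ : DiffSub.Univalent
      (fun z => σ * DiffSub.opF p η μ f z + γ * (z * deriv (DiffSub.opF p η μ f) z)) :=
    ⟨hFh.linear_field σ γ, hΨ.2.congr hΨF⟩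
  have hu₁ := hq₁.univalent_linear_field hγ hσγ
  have hu₂ := hq₂.univalent_linear_field hγ hσγ
  have h₁₂ := h₁.trans h₂
  -- both extremal functions solve the two differential relations simultaneously
  have hmem₁ : q₁ ∈ DiffSub.superordSolutions (DiffSub.linForm σ γ)
      (fun z => σ * q₁ z + γ * (z * deriv q₁ z)) := ⟨hq₁.1, hu₁, .refl hu₁.1⟩
  have hmem₂ : q₂ ∈ DiffSub.subordSolutions (DiffSub.linForm σ γ)
      (fun z => σ * q₂ z + γ * (z * deriv q₂ z)) := ⟨hq₂.1.1, .refl hu₂.1⟩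
  have hmem₁₂ : q₁ ∈ DiffSub.subordSolutions (DiffSub.linForm σ γ)
      (fun z => σ * q₂ z + γ * (z * deriv q₂ z)) := ⟨hq₁.1.1, h₁₂⟩
  have hmem₂₁ : q₂ ∈ DiffSub.superordSolutions (DiffSub.linForm σ γ)
      (fun z => σ * q₁ z + γ * (z * deriv q₁ z)) := ⟨hq₂.1, hu₂, h₁₂⟩
  have hsub : ∀ u ∈ DiffSub.superordSolutions (DiffSub.linForm σ γ)
      (fun z => σ * q₁ z + γ * (z * deriv q₁ z)), DiffSub.Subordinate q₁ u := fun u hu =>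
    hq₁.subordinate_of_linear_field_superordinate hγ hσγ hu.1 hu.2.1 hu.2.2
  have hdom : ∀ u ∈ DiffSub.subordSolutions (DiffSub.linForm σ γ)
      (fun z => σ * q₂ z + γ * (z * deriv q₂ z)), DiffSub.Subordinate u q₂ := fun u hu =>
    hq₂.subordinate_of_linear_field hγ hσγ hu.1 hu.2
  exact ⟨hsub _ ⟨DiffSub.univalent_of_mem_QClass hFh hF.2, hΦ, h₁.congr_right hΨF⟩,
    hdom _ ⟨hFh, h₂.congr_left hΨF⟩,
    ⟨hu₁, DiffSub.bestSubordinantOf_of_mem hq₁.1 hmem₁ hsub⟩,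
    ⟨hu₂, DiffSub.bestDominantOf_of_mem hq₂.1 hmem₂ hdom⟩,
    DiffSub.bestSubordinantOf_of_mem hq₁.1 ⟨hmem₁, hmem₁₂⟩ fun u hu => hsub u hu.1,
    DiffSub.bestDominantOf_of_mem hq₂.1 ⟨hmem₂₁, hmem₂⟩ fun u hu => hdom u hu.2⟩
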